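/- **Setting.** Let $X$ be a finite simplicial complex and let $X^{(k)}$ be its set of $k$-simplices for $k\ge -1$, with $X^{(-1)}=\{\emptyset\}$. Suppose that $X$ is pure of dimension $n$: no simplex has dimension above $n$, and every simplex is contained in an $n$-simplex. A *weight* on $X$ is a function $m:\bigcup_{-1\le k\le n}X^{(k)}\to(0,\infty)$ with $$m(\tau)=\sum_{\sigma\in X^{(k+1)},\ \tau\subset\sigma}m(\sigma)\qquad(-1\le k\le n-1,\ \tau\in X^{(k)}).$$ Write $m(X^{(k)})=\sum_{\sigma\in X^{(k)}}m(\sigma)$. For $\tau\in X^{(j)}$ the link $X_\tau$ is the complex of all simplices $\sigma$ of $X$ with $\sigma\cap\tau=\emptyset$ and $\sigma\cup\tau\in X$. It has dimension $n-j-1$, it carries the weight $m_\tau(\sigma)=m(\tau\cup\sigma)$, and $X_\emptyset=X$. Let $\lambda(X_\tau)$ be the smallest positive eigenvalue of the weighted graph Laplacian $$\Delta^+f(v)=f(v)-\frac1{m_\tau(\{v\})}\sum_{u:\ \{u,v\}\in X_\tau^{(1)}}m_\tau(\{u,v\})f(u)$$ acting on functions $f:X_\tau^{(0)}\to\mathbb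 R$. For $\frac{n-1}{n}<\lambda\le1$, the weighted complex $X$ has *$\lambda$-local spectral expansion* if all links of $X$ of dimension $>0$ (including $X$ itself) are connected and $\lambda(X_\tau)\ge\lambda$ for every $\tau\in X^{(n-2)}$. Let $C^k(X,\mathbb F_2)$ be the space of functions $\phi:X^{(k)}\to\mathbb F_2$. Set $d\phi(\sigma)=\sum_{\tau\in X^{(k)},\,\tau\subset\sigma}\phi(\tau)$ for $\sigma\in X^{(k+1)}$, set $B^k(X,\mathbb F_2)=d\,C^{k-1}(X,\mathbb F_2)$, and set $\|\phi\|=\sum_{\tau\in X^{(k)},\,\phi(\tau)=1}m(\tau)$; the same notions are used on each link with its weight $m_\tau$. Let $\varepsilon>0$. A cochain $\phi\in C^0(X,\mathbb F_2)$ is *$\varepsilon$-locally minimal* if $\|\phi\|\le\frac{1+\varepsilon}2m(X^{(0)})$. For $k\ge1$, a cochain $\phi\in C^k(X,\mathbb F_2)$ is *$\varepsilon$-locally minimal* if for all $0\le j\le k-1$, all $\tau\in X^{(j)}$ and all $\psi\in B^{k-j-1}(X_\tau,\mathbb F_2)$, $$\|\phi_\tau\|\le\|\phi_\tau-\psi\|+\varepsilon\,m(\tau),$$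 where $\phi_\tau\in C^{k-j-1}(X_\tau,\mathbb F_2)$ is given by $\phi_\tau(\sigma)=\phi(\tau\cup\sigma)$. **Theorem.** For every integer $n>1$ there are constants $\frac{n-1}{n}<\Lambda_1<1$, $\varepsilon>0$ and $C_1>0$ such that for every finite pure $n$-dimensional weighted simplicial complex $X$ with $\lambda$-local spectral expansion, where $\lambda\ge\Lambda_1$, the following hold. 1. For every $0\ne\phi\in C^0(X,\mathbb F_2)$: if $\phi$ is $\varepsilon$-locally minimal, then $\|d\phi\|>0$. 2. For every $0\ne\phi\in C^1(X,\mathbb F_2)$: if $\phi$ is $\varepsilon$-locally minimal and $\|\phi\|\le C_1\,m(X^{(1)})$, then $\|d\phi\|\ge\frac14\|\phi\|>0$. -/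

import Mathlib

/-- A finite abstract simplicial complex with vertices in `V`: a finite, downward closed family of
finite sets. The empty simplex (of dimension `-1`) is recorded as a face, as is needed for links and
for cochains in degree `-1`; this is why `PreAbstractSimplicialComplex`, whose faces are nonempty,
is not used. The family with no face at all is excluded by `IsPure` below. -/
structure FinComplex (V : Type*) where
  faces : Finset (Finset V)
  down_closed : ∀ σ ∈ faces, ∀ τ, τ ⊆ σ → τ ∈ faces

namespace FinComplex

variable {V : Type*}

/-- `X^(k)`: the simplices of dimension `k` (those with `k + 1` vertices), `k ≥ -1`. -/
def simplices (X : FinComplex V) (k : ℤ) : Finset (Finset V) :=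
  X.faces.filter fun σ => (σ.card : ℤ) = k + 1

theorem mem_simplices {X : FinComplex V} {k : ℤ} {σ : Finset V} :
    σ ∈ X.simplices k ↔ σ ∈ X.faces ∧ (σ.card : ℤ) = k + 1 := by
  simp [simplices]

/-- `X` is pure of dimension `n`: it has a face, no simplex has dimension above `n`, and each
simplex (the empty one included) is a face of an `n`-dimensional one. -/
def IsPure (X : FinComplex V) (n : ℕ) : Prop :=
  X.faces.Nonempty ∧ (∀ σ ∈ X.faces, σ.card ≤ n + 1) ∧
    ∀ σ ∈ X.faces, ∃ η ∈ X.simplices n, σ ⊆ η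

variable [DecidableEq V]

/-- `m` is a weight function on the `n`-dimensional complex `X`: it is positive on all simplices and
`m(τ) = ∑ m(σ)`, over the `(k+1)`-simplices `σ` containing `τ`, for each `k`-simplex `τ` with
`-1 ≤ k ≤ n - 1`. Values of `m` outside `X` are never used. -/
def IsWeight (X : FinComplex V) (n : ℕ) (m : Finset V → ℝ) : Prop :=
  (∀ σ ∈ X.faces, 0 < m σ) ∧
    ∀ k : ℤ, -1 ≤ k → k ≤ n - 1 → ∀ τ ∈ X.simplices k,
      m τ = ∑ σ ∈ X.simplices (k + 1) with τ ⊆ σ, m σ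

/-- The link `X_τ`: the simplices disjoint from `τ` whose union with `τ` is in `X`. -/
def link (X : FinComplex V) (τ : Finset V) : FinComplex V where
  faces := X.faces.filter fun σ => Disjoint τ σ ∧ τ ∪ σ ∈ X.faces
  down_closed := by
    intro σ hσ ρ hρ
    rw [Finset.mem_filter] at hσ ⊢
    exact ⟨X.down_closed σ hσ.1 ρ hρ, Finset.disjoint_of_subset_right hρ hσ.2.1,
      X.down_closed _ hσ.2.2 _ (Finset.union_subset_union_right hρ)⟩

/-- The weight `m_τ(σ) = m(τ ∪ σ)` on the link `X_τ`. -/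
def linkWeight (m : Finset V → ℝ) (τ : Finset V) : Finset V → ℝ := fun σ => m (τ ∪ σ)

/-! ### The weighted graph given by the 1-skeleton -/

/-- The 1-skeleton of `X`, as a graph on `X^(0)`. -/
def skeletonGraph (X : FinComplex V) : SimpleGraph (X.simplices 0) where
  Adj u v := (u : Finset V) ∪ v ∈ X.simplices 1
  symm := ⟨fun u v h => by rwa [Finset.union_comm]⟩
  loopless := ⟨fun u h => by
    have h1 := (mem_simplices.mp u.2).2
    have h2 := (mem_simplices.mp h).2
    rw [Finset.union_self] at h2
    omega⟩

/-- A complex is connected when its 1-skeleton is. -/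
def IsConnected (X : FinComplex V) : Prop := X.skeletonGraph.Connected

/-- The Laplacian of the weighted 1-skeleton, acting on `C^0(X, ℝ)`:
`Δφ(v) = φ(v) - (1 / m(v)) ∑ m({u,v}) φ(u)`, over the vertices `u` with `{u,v}` an edge. -/
noncomputable def laplacian (X : FinComplex V) (m : Finset V → ℝ) :
    (X.simplices 0 → ℝ) →ₗ[ℝ] (X.simplices 0 → ℝ) where
  toFun φ v := φ v - 1 / m v *
    ∑ u : X.simplices 0 with u.1 ∪ v.1 ∈ X.simplices 1, m (u.1 ∪ v.1) * φ u
  map_add' φ ψ := by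
    funext v
    simp only [Pi.add_apply, mul_add, Finset.sum_add_distrib]
    ring
  map_smul' c φ := by
    funext v
    simp only [Pi.smul_apply, smul_eq_mul, RingHom.id_apply, mul_left_comm _ c,
      ← Finset.mul_sum]
    ring

/-- `λ(X)`: the smallest positive eigenvalue of the Laplacian of the weighted 1-skeleton. (The set
is finite, and it is nonempty as soon as `X` has an edge.) -/
noncomputable def spectralGap (X : FinComplex V) (m : Finset V → ℝ) : ℝ :=
  sInf {μ : ℝ | 0 < μ ∧ Module.End.HasEigenvalue (X.laplacian m) μ}

/-- `l`-local spectral expansion of an `n`-dimensional weighted complex: `(n-1)/n < l ≤ 1`, the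
links of dimension `> 0` (those of the `j`-simplices with `-1 ≤ j ≤ n - 2`, so that `X` itself is
included) are connected, and the 1-dimensional links (those of the `(n-2)`-simplices) have spectral
gap at least `l`. -/
def HasLocalSpectralExpansion (X : FinComplex V) (n : ℕ) (m : Finset V → ℝ) (l : ℝ) : Prop :=
  ((n : ℝ) - 1) / n < l ∧ l ≤ 1 ∧
    (∀ j : ℤ, -1 ≤ j → j ≤ n - 2 → ∀ τ ∈ X.simplices j, (X.link τ).IsConnected) ∧
    ∀ τ ∈ X.simplices (n - 2), l ≤ (X.link τ).spectralGap (linkWeight m τ)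

/-! ### Cochains over the field with two elements -/

/-- `C^k(X, F₂)`. -/
abbrev Cochain (X : FinComplex V) (k : ℤ) : Type _ := X.simplices k → ZMod 2

/-- The differential `d_k : C^k(X, F₂) → C^l(X, F₂)`, always used with `l = k + 1`:
`dφ(σ) = ∑ φ(τ)` over the `k`-simplices `τ` contained in `σ`. The target degree is a separate
argument so that for instance `d_{k-1}` takes values in `C^k` itself. -/
def coboundary (X : FinComplex V) (k l : ℤ) (φ : X.Cochain k) : X.Cochain l :=
  fun σ => ∑ τ : X.simplices k, if (τ : Finset V) ⊆ σ then φ τ else 0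

/-- `B^k(X, F₂)`, the image of `d_{k-1} : C^{k-1} → C^k`. -/
def coboundaries (X : FinComplex V) (k : ℤ) : Set (X.Cochain k) :=
  Set.range (X.coboundary (k - 1) k)

/-- `‖φ‖ = ∑ m(τ)` over the `k`-simplices `τ` with `φ(τ) = 1`. -/
def cochainNorm (X : FinComplex V) (m : Finset V → ℝ) {k : ℤ} (φ : X.Cochain k) : ℝ :=
  ∑ τ : X.simplices k with φ τ = 1, m τ

/-- `m(X^(k))`, the total weight of the `k`-simplices. -/
def totalWeight (X : FinComplex V) (m : Finset V → ℝ) (k : ℤ) : ℝ :=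
  ∑ σ ∈ X.simplices k, m σ

theorem union_mem_simplices {X : FinComplex V} {j k : ℤ} {τ σ : Finset V}
    (hτ : τ ∈ X.simplices j) (hσ : σ ∈ (X.link τ).simplices (k - j - 1)) :
    τ ∪ σ ∈ X.simplices k := by
  rw [mem_simplices] at hτ hσ ⊢
  have h := (Finset.mem_filter.mp hσ.1).2
  refine ⟨h.2, ?_⟩
  rw [Finset.card_union_of_disjoint h.1]
  push_cast
  omega

/-- The localization `φ_τ ∈ C^{k-j-1}(X_τ, F₂)` of `φ ∈ C^k(X, F₂)` at a `j`-simplex `τ`: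
`φ_τ(σ) = φ(τ ∪ σ)`. -/
def localization {X : FinComplex V} {j k : ℤ} {τ : Finset V} (hτ : τ ∈ X.simplices j)
    (φ : X.Cochain k) : (X.link τ).Cochain (k - j - 1) :=
  fun σ => φ ⟨τ ∪ σ, union_mem_simplices hτ σ.2⟩

/-- `φ ∈ C^k(X, F₂)`, `k ≥ 0`, is `ε`-locally minimal. For `k = 0`: `‖φ‖ ≤ (1 + ε) m(X^(0)) / 2`.
For `k ≥ 1`: `‖φ_τ‖ ≤ ‖φ_τ - ψ‖ + ε m(τ)` for all `0 ≤ j ≤ k - 1`, all `j`-simplices `τ` and all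
`ψ ∈ B^{k-j-1}(X_τ, F₂)`, with norms taken in the weighted complex `X_τ`. -/
def IsEpsLocallyMinimal (X : FinComplex V) (m : Finset V → ℝ) (ε : ℝ) {k : ℤ}
    (φ : X.Cochain k) : Prop :=
  (k = 0 → X.cochainNorm m φ ≤ (1 + ε) * X.totalWeight m 0 / 2) ∧
    (1 ≤ k → ∀ j : ℤ, 0 ≤ j → j ≤ k - 1 → ∀ (τ : Finset V) (hτ : τ ∈ X.simplices j),
      ∀ ψ ∈ (X.link τ).coboundaries (k - j - 1),
        (X.link τ).cochainNorm (linkWeight m τ) (localization hτ φ) ≤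
          (X.link τ).cochainNorm (linkWeight m τ) (localization hτ φ - ψ) + ε * m τ)

end FinComplex

/-!
For a cochain of degree `0` only connectedness matters: the cochain takes both values, hence changes
along some edge.

Let `φ` be a cochain of degree `1` with support `S`, and let `t i` be the weight of the triangles
with exactly `i` edges in `S`, so that `‖φ‖ = t 1 + 2 t 2 + 3 t 3` and `‖dφ‖ = t 1 + t 3`. Pairs of
adjacent edges of `S`, weighted by the triangle which they span, have total weight `2 t 2 + 6 t 3`
(`pathSum`), so `‖φ‖ - ‖dφ‖` is at most this weight (`cochainNorm_sub_pathSum_le`), and it is enough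
to bound the latter by `3 / 4 * ‖φ‖` (`pathSum_le_of_small`). In the link of a vertex `c` such pairs
are the edges inside `S_c`, the set of the vertices joined to `c` by `S`. Since the link has almost
no spectrum between `0` and `1`, their weight is about `A_c ^ 2 / m c`, where `A_c` is the weight of
`S_c` (`pathSum_le`). This is negligible against `A_c` unless `c` is thick, that is, `S_c` takes up
a fixed small proportion of the link; and by local minimality it is not much more than `A_c / 2` in
any case. The numbers `A_c` add up to `2 ‖φ‖`, and those at thick vertices to little more than
`‖φ‖`: as `‖φ‖` is small the thick vertices have small total weight, and by the spectral gap of `X`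
there are few edges between them (`sum_localNorm_le`). This makes the path sum little more than
`‖φ‖ / 2`.

The gaps of `X` and of its vertex links come from those of the one-dimensional links by Oppenheim's
trickling-down argument (`hasGap_of_link`): decomposing the averaging operator of a connected
complex over the links of its vertices gives `θ ≤ μ + (1 - μ) θ ^ 2` for each of its eigenvalues
`θ`, if `μ` bounds the eigenvalues on the links. To use links inductively, gaps are stated as bounds
on quadratic forms (`HasGap`), and the spectral theorem (`rayleigh_le_of_eigenvalue_le`) leads back
from eigenvalues to such bounds.
-/

/-! ### Rayleigh quotients of weighted graphs -/

section WeightedGraph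

variable {ι : Type*} [Fintype ι]

/-- Centring `f` at its weighted mean removes the contribution of the constants from both sides, so
that the bound on functions of mean zero gives the bound on all functions. -/
theorem rayleigh_le_of_mean_zero (m : ι → ℝ) (hm : 0 < ∑ i, m i)
    (w : ι → ι → ℝ) (hsymm : ∀ i j, w i j = w j i) (hrow : ∀ i, ∑ j, w i j = m i) (μ : ℝ)
    (h : ∀ f : ι → ℝ, ∑ i, m i * f i = 0 →
      ∑ i, ∑ j, w i j * f i * f j ≤ μ * ∑ i, m i * f i ^ 2) (f : ι → ℝ) :
    ∑ i, ∑ j, w i j * f i * f j ≤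
      μ * ∑ i, m i * f i ^ 2 + (1 - μ) * (∑ i, m i * f i) ^ 2 / ∑ i, m i := by
  set T := ∑ i, m i with hT
  set A := ∑ i, m i * f i with hA
  set c := A / T with hc
  have hcT : c * T = A := by rw [hc]; field_simp
  have h1 : ∑ i, m i * (f i - c) = 0 := by
    simp only [mul_sub, Finset.sum_sub_distrib, ← Finset.sum_mul, ← hT, ← hA]
    linarith
  have h2 := h _ h1
  have h3 : ∑ i, m i * (f i - c) ^ 2 = ∑ i, m i * f i ^ 2 - c * A := by
    have : ∀ i, m i * (f i - c) ^ 2 = m i * f i ^ 2 - 2 * c * (m i * f i) + c ^ 2 * m i :=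
      fun i => by ring
    simp only [this, Finset.sum_add_distrib, Finset.sum_sub_distrib, ← Finset.mul_sum, ← hT, ← hA]
    linear_combination c * hcT
  have hcol : ∑ i, ∑ j, w i j * f j = A := by
    rw [Finset.sum_comm, hA]
    refine Finset.sum_congr rfl fun i _ => ?_
    rw [← hrow i, Finset.sum_mul]
    exact Finset.sum_congr rfl fun j _ => by rw [hsymm]
  have hrow' : ∑ i, ∑ j, w i j * f i = A :=
    Finset.sum_congr rfl fun i _ => by rw [← hrow i, Finset.sum_mul]
  have htot : ∑ i, ∑ j, w i j = T := Finset.sum_congr rfl fun i _ => hrow i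
  have h4 : ∑ i, ∑ j, w i j * (f i - c) * (f j - c) = ∑ i, ∑ j, w i j * f i * f j - c * A := by
    have : ∀ i j, w i j * (f i - c) * (f j - c) =
        w i j * f i * f j - c * (w i j * f i) - c * (w i j * f j) + c ^ 2 * w i j :=
      fun i j => by ring
    simp only [this, Finset.sum_add_distrib, Finset.sum_sub_distrib, ← Finset.mul_sum, hcol,
      hrow', htot]
    linear_combination c * hcT
  rw [h3, h4] at h2
  have h5 : (1 - μ) * A ^ 2 / T = (1 - μ) * (c * A) := by rw [hc]; ring
  rw [h5]
  linarith

/-- The Dirichlet form of a weighted graph whose vertex weights are the row sums of `w`. -/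
theorem sum_mul_sub_sq (m : ι → ℝ) (w : ι → ι → ℝ) (hsymm : ∀ i j, w i j = w j i)
    (hrow : ∀ i, ∑ j, w i j = m i) (f : ι → ℝ) :
    ∑ i, ∑ j, w i j * (f i - f j) ^ 2 =
      2 * (∑ i, m i * f i ^ 2 - ∑ i, ∑ j, w i j * f i * f j) := by
  have h1 : ∑ i, ∑ j, w i j * f i ^ 2 = ∑ i, m i * f i ^ 2 :=
    Finset.sum_congr rfl fun i _ => by rw [← hrow i, Finset.sum_mul]
  have h2 : ∑ i, ∑ j, w i j * f j ^ 2 = ∑ i, m i * f i ^ 2 := by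
    rw [Finset.sum_comm, ← h1]
    exact Finset.sum_congr rfl fun i _ => Finset.sum_congr rfl fun j _ => by rw [hsymm]
  have : ∀ i j, w i j * (f i - f j) ^ 2 =
      w i j * f i ^ 2 - 2 * (w i j * f i * f j) + w i j * f j ^ 2 := fun i j => by ring
  simp only [this, Finset.sum_add_distrib, Finset.sum_sub_distrib, ← Finset.mul_sum, h1, h2]
  ring

/-- On a connected weighted graph, an eigenfunction of the averaging operator for an eigenvalue at
least `1` is constant, as its Dirichlet form is nonpositive. -/
theorem eq_of_one_le_eigenvalue (G : SimpleGraph ι) (hG : G.Connected) (m : ι → ℝ)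
    (hm : ∀ i, 0 < m i) (w : ι → ι → ℝ) (hsymm : ∀ i j, w i j = w j i)
    (hw : ∀ i j, 0 ≤ w i j) (hadj : ∀ i j, G.Adj i j → 0 < w i j)
    (hrow : ∀ i, ∑ j, w i j = m i) {θ : ℝ} (hθ : 1 ≤ θ) {f : ι → ℝ}
    (hf : ∀ i, ∑ j, w i j * f j = θ * m i * f i) (i j : ι) : f i = f j := by
  have h1 := sum_mul_sub_sq m w hsymm hrow f
  have h2 : ∑ i, ∑ j, w i j * f i * f j = θ * ∑ i, m i * f i ^ 2 := by
    rw [Finset.mul_sum]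
    refine Finset.sum_congr rfl fun i _ => ?_
    have := hf i
    calc ∑ j, w i j * f i * f j = f i * ∑ j, w i j * f j := by
          rw [Finset.mul_sum]; exact Finset.sum_congr rfl fun j _ => by ring
      _ = _ := by rw [this]; ring
  have h3 : 0 ≤ ∑ i, m i * f i ^ 2 :=
    Finset.sum_nonneg fun i _ => mul_nonneg (hm i).le (sq_nonneg _)
  have h4 : ∀ i j, 0 ≤ w i j * (f i - f j) ^ 2 := fun i j => mul_nonneg (hw i j) (sq_nonneg _)
  have h5 : ∑ i, ∑ j, w i j * (f i - f j) ^ 2 = 0 := by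
    refine le_antisymm ?_ (Finset.sum_nonneg fun i _ => Finset.sum_nonneg fun j _ => h4 i j)
    rw [h1, h2]; nlinarith
  have h6 : ∀ i j, G.Adj i j → f i = f j := by
    intro i j hij
    rw [Finset.sum_eq_zero_iff_of_nonneg fun i _ => Finset.sum_nonneg fun j _ => h4 i j] at h5
    have h7 := h5 i (Finset.mem_univ _)
    rw [Finset.sum_eq_zero_iff_of_nonneg fun j _ => h4 i j] at h7
    have h8 := h7 j (Finset.mem_univ _)
    rcases mul_eq_zero.mp h8 with h | h
    · exact absurd h (hadj i j hij).ne'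
    · exact sub_eq_zero.mp (pow_eq_zero_iff two_ne_zero |>.mp h)
  obtain ⟨p⟩ := hG.preconnected i j
  induction p with
  | nil => rfl
  | cons hadj' _ ih => exact (h6 _ _ hadj').trans ih

/-- On a connected weighted graph, a bound on the eigenvalues `θ < 1` of the averaging operator
`f ↦ (1 / m i) ∑ j, w i j * f j` bounds its Rayleigh quotients, up to the contribution of the
constant functions. -/
theorem rayleigh_le_of_eigenvalue_le (G : SimpleGraph ι) (hG : G.Connected) (m : ι → ℝ)
    (hm : ∀ i, 0 < m i) (w : ι → ι → ℝ) (hsymm : ∀ i j, w i j = w j i)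
    (hw : ∀ i j, 0 ≤ w i j) (hadj : ∀ i j, G.Adj i j → 0 < w i j)
    (hrow : ∀ i, ∑ j, w i j = m i) (μ : ℝ)
    (hμ : ∀ θ < 1, ∀ f : ι → ℝ, f ≠ 0 → (∀ i, ∑ j, w i j * f j = θ * m i * f i) → θ ≤ μ)
    (f : ι → ℝ) :
    ∑ i, ∑ j, w i j * f i * f j ≤
      μ * ∑ i, m i * f i ^ 2 + (1 - μ) * (∑ i, m i * f i) ^ 2 / ∑ i, m i := by
  classical
  have := hG.nonempty
  refine rayleigh_le_of_mean_zero m (Finset.sum_pos (fun i _ => hm i) Finset.univ_nonempty)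
    w hsymm hrow μ (fun f hf => ?_) f
  have hs : ∀ i, 0 < √(m i) := fun i => Real.sqrt_pos.mpr (hm i)
  have hss : ∀ i, √(m i) * √(m i) = m i := fun i => Real.mul_self_sqrt (hm i).le
  -- conjugating by `√m` turns the averaging operator into a symmetric matrix
  let B : Matrix ι ι ℝ := Matrix.of fun i j => w i j / (√(m i) * √(m j))
  have hB : B.IsHermitian := by
    ext i j
    simp [B, hsymm i j, mul_comm]
  let e := hB.eigenvectorBasis
  let F : EuclideanSpace ℝ ι := WithLp.toLp 2 fun i => √(m i) * f i
  have hmul : ∀ k i, ∑ j, B i j * e k j = hB.eigenvalues k * e k i := fun k i => by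
    have := congrFun (hB.mulVec_eigenvectorBasis k) i
    simpa [Matrix.mulVec, dotProduct] using this
  -- each coordinate of `F` in the eigenbasis vanishes or has eigenvalue at most `μ`
  have hcoord : ∀ k, inner ℝ (e k) F = 0 ∨ hB.eigenvalues k ≤ μ := by
    intro k
    set θ := hB.eigenvalues k with hθ
    let g : ι → ℝ := fun i => e k i / √(m i)
    have hek : ∀ i, e k i = √(m i) * g i := fun i => by
      have := (hs i).ne'
      simp only [g]; field_simp
    have hg : ∀ i, ∑ j, w i j * g j = θ * m i * g i := by
      intro i
      have h1 := hmul k i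
      have h2 : ∑ j, w i j * g j = √(m i) * ∑ j, B i j * e k j := by
        rw [Finset.mul_sum]
        refine Finset.sum_congr rfl fun j _ => ?_
        have h3 := (hs i).ne'
        have h4 := (hs j).ne'
        simp only [B, g, Matrix.of_apply]
        field_simp
      rw [h2, h1, hek, ← hθ]
      linear_combination θ * g i * hss i
    by_cases h : θ < 1
    · right
      refine hμ θ h g (fun h0 => ?_) hg
      have : e k = 0 := by
        ext i
        rw [hek, h0]; simp
      have h1 := e.orthonormal.1 k
      rw [this] at h1
      simp at h1
    · left
      have hc := eq_of_one_le_eigenvalue G hG m hm w hsymm hw hadj hrow (not_lt.mp h) hg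
      obtain ⟨i₀⟩ := hG.nonempty
      have : inner ℝ (e k) F = g i₀ * ∑ i, m i * f i := by
        rw [PiLp.inner_apply, Finset.mul_sum]
        refine Finset.sum_congr rfl fun i _ => ?_
        simp only [F, RCLike.inner_apply, conj_trivial]
        rw [hek, hc i i₀]
        linear_combination f i * g i₀ * hss i
      rw [this, hf, mul_zero]
  have hnorm : ∑ i, m i * f i ^ 2 = ∑ k, inner ℝ (e k) F ^ 2 := by
    have h1 := e.sum_inner_mul_inner F F
    have h2 : inner ℝ F F = ∑ i, m i * f i ^ 2 := by
      rw [PiLp.inner_apply]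
      refine Finset.sum_congr rfl fun i _ => ?_
      simp only [F, RCLike.inner_apply, conj_trivial]
      linear_combination f i ^ 2 * hss i
    rw [← h2, ← h1]
    exact Finset.sum_congr rfl fun k _ => by rw [real_inner_comm, sq]
  have hform : ∑ i, ∑ j, w i j * f i * f j = ∑ k, hB.eigenvalues k * inner ℝ (e k) F ^ 2 := by
    let BF : EuclideanSpace ℝ ι := WithLp.toLp 2 (B.mulVec F)
    have h1 := e.sum_inner_mul_inner F BF
    have h2 : inner ℝ F BF = ∑ i, ∑ j, w i j * f i * f j := by
      rw [PiLp.inner_apply]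
      refine Finset.sum_congr rfl fun i _ => ?_
      simp only [F, BF, B, RCLike.inner_apply, conj_trivial, Matrix.mulVec, dotProduct,
        Matrix.of_apply, Finset.sum_mul]
      refine Finset.sum_congr rfl fun j _ => ?_
      have h3 := (hs i).ne'
      have h4 := (hs j).ne'
      field_simp
    rw [← h2, ← h1]
    refine Finset.sum_congr rfl fun k _ => ?_
    have h3 : inner ℝ (e k) BF = hB.eigenvalues k * inner ℝ (e k) F := by
      simp only [PiLp.inner_apply, BF, RCLike.inner_apply, conj_trivial, Matrix.mulVec,
        dotProduct, Finset.sum_mul, Finset.mul_sum]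
      rw [Finset.sum_comm]
      refine Finset.sum_congr rfl fun j _ => ?_
      have h4 := hmul k j
      calc ∑ i, B i j * F j * e k i = F j * ∑ i, B j i * e k i := by
            rw [Finset.mul_sum]
            refine Finset.sum_congr rfl fun i _ => ?_
            rw [← hB.apply i j]; simp; ring
        _ = _ := by rw [h4]; ring
    rw [h3, real_inner_comm]; ring
  rw [hform, hnorm, Finset.mul_sum]
  refine Finset.sum_le_sum fun k _ => ?_
  rcases hcoord k with h | h
  · simp [h]
  · exact mul_le_mul_of_nonneg_right h (sq_nonneg _)

end WeightedGraph

namespace FinComplex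

variable {V : Type*} [DecidableEq V]

/-! ### Edge and triangle weights -/

/-- The weight of the edge `a ∪ b`, where vertices are encoded as one-element simplices, and `0`
when `a ∪ b` is not an edge. -/
noncomputable def edgeWeight (X : FinComplex V) (m : Finset V → ℝ) (a b : Finset V) : ℝ :=
  if a ∪ b ∈ X.simplices 1 then m (a ∪ b) else 0

/-- The weight of the triangle `c ∪ a ∪ b`, and `0` when `c ∪ a ∪ b` is not a triangle. -/
noncomputable def triangleWeight (X : FinComplex V) (m : Finset V → ℝ) (c a b : Finset V) : ℝ :=
  if c ∪ (a ∪ b) ∈ X.simplices 2 then m (c ∪ (a ∪ b)) else 0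

variable {X : FinComplex V} {m : Finset V → ℝ} {n : ℕ}

theorem IsWeight.pos (hm : X.IsWeight n m) {k : ℤ} {σ : Finset V} (hσ : σ ∈ X.simplices k) :
    0 < m σ :=
  hm.1 σ (mem_simplices.mp hσ).1

theorem edgeWeight_comm (a b : Finset V) : X.edgeWeight m a b = X.edgeWeight m b a := by
  simp only [edgeWeight, Finset.union_comm]

theorem edgeWeight_nonneg (hm : X.IsWeight n m) (a b : Finset V) : 0 ≤ X.edgeWeight m a b := by
  unfold edgeWeight
  split_ifs with h
  · exact (hm.pos h).le
  · exact le_rfl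

theorem triangleWeight_nonneg (hm : X.IsWeight n m) (c a b : Finset V) :
    0 ≤ X.triangleWeight m c a b := by
  unfold triangleWeight
  split_ifs with h
  · exact (hm.pos h).le
  · exact le_rfl

theorem triangleWeight_swap (c a b : Finset V) :
    X.triangleWeight m c a b = X.triangleWeight m c b a := by
  simp only [triangleWeight, Finset.union_comm a b]

theorem triangleWeight_rotate (c a b : Finset V) :
    X.triangleWeight m c a b = X.triangleWeight m a b c := by
  have : c ∪ (a ∪ b) = a ∪ (b ∪ c) := by
    rw [Finset.union_comm c, Finset.union_assoc]
  simp only [triangleWeight, this]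

/-- Three vertices whose union is a triangle span edges pairwise. -/
theorem union_mem_simplices_one {a b c : Finset V} (ha : a ∈ X.simplices 0)
    (hb : b ∈ X.simplices 0) (hc : c ∈ X.simplices 0) (h : c ∪ (a ∪ b) ∈ X.simplices 2) :
    a ∪ b ∈ X.simplices 1 := by
  rw [mem_simplices] at *
  refine ⟨X.down_closed _ h.1 _ Finset.subset_union_right, ?_⟩
  have h1 := Finset.card_union_le c (a ∪ b)
  have h2 := Finset.card_union_le a b
  omega

/-- Summing over the simplices that contain `σ` as a facet amounts to summing over vertices. -/
theorem sum_union_vertex {k : ℤ} {σ : Finset V} (hσ : σ ∈ X.simplices k) (F : Finset V → ℝ) :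
    ∑ b ∈ X.simplices 0, (if σ ∪ b ∈ X.simplices (k + 1) then F (σ ∪ b) else 0) =
      ∑ ρ ∈ X.simplices (k + 1) with σ ⊆ ρ, F ρ := by
  rw [← Finset.sum_filter]
  have hσ' := mem_simplices.mp hσ
  refine Finset.sum_nbij' (fun b => σ ∪ b) (fun ρ => ρ \ σ) ?_ ?_ ?_ ?_ ?_
  · intro b hb
    rw [Finset.mem_filter] at hb ⊢
    exact ⟨hb.2, Finset.subset_union_left⟩
  · intro ρ hρ
    rw [Finset.mem_filter] at hρ ⊢
    have h1 := mem_simplices.mp hρ.1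
    rw [Finset.union_sdiff_of_subset hρ.2]
    refine ⟨mem_simplices.mpr ⟨X.down_closed _ h1.1 _ Finset.sdiff_subset, ?_⟩, hρ.1⟩
    have h2 := Finset.card_sdiff_add_card_eq_card hρ.2
    omega
  · intro b hb
    rw [Finset.mem_filter] at hb
    have h1 := mem_simplices.mp hb.1
    have h2 := mem_simplices.mp hb.2
    have h3 : Disjoint σ b := by
      rw [← Finset.card_union_eq_card_add_card]
      have := Finset.card_union_le σ b
      omega
    rw [Finset.union_sdiff_left, Finset.sdiff_eq_self_of_disjoint h3.symm]
  · intro ρ hρ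
    rw [Finset.mem_filter] at hρ
    exact Finset.union_sdiff_of_subset hρ.2
  · intro b _
    rfl

theorem IsWeight.sum_vertex (hm : X.IsWeight n m) {k : ℤ} (hk : -1 ≤ k) (hkn : k ≤ n - 1)
    {σ : Finset V} (hσ : σ ∈ X.simplices k) :
    ∑ b ∈ X.simplices 0, (if σ ∪ b ∈ X.simplices (k + 1) then m (σ ∪ b) else 0) = m σ := by
  rw [hm.2 k hk hkn σ hσ, sum_union_vertex hσ]

theorem IsWeight.sum_vertices (hm : X.IsWeight n m) (h0 : ∅ ∈ X.faces) :
    ∑ a ∈ X.simplices 0, m a = m ∅ := by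
  rw [← hm.sum_vertex (k := -1) le_rfl (by omega) (mem_simplices.mpr ⟨h0, by simp⟩)]
  refine Finset.sum_congr rfl fun a ha => ?_
  rw [Finset.empty_union]
  exact (if_pos ha).symm

theorem IsWeight.sum_edgeWeight (hm : X.IsWeight n m) (hn : 1 ≤ n) {a : Finset V}
    (ha : a ∈ X.simplices 0) : ∑ b ∈ X.simplices 0, X.edgeWeight m a b = m a :=
  hm.sum_vertex (k := 0) (by omega) (by omega) ha

theorem IsWeight.sum_triangleWeight (hm : X.IsWeight n m) (hn : 2 ≤ n) {a b : Finset V}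
    (ha : a ∈ X.simplices 0) (hb : b ∈ X.simplices 0) :
    ∑ c ∈ X.simplices 0, X.triangleWeight m c a b = X.edgeWeight m a b := by
  unfold edgeWeight
  split_ifs with h
  · rw [← hm.sum_vertex (k := 1) (by omega) (by omega) h]
    refine Finset.sum_congr rfl fun c _ => ?_
    rw [triangleWeight, Finset.union_comm c]
    rfl
  · refine Finset.sum_eq_zero fun c hc => ?_
    rw [triangleWeight, if_neg fun h1 => h (union_mem_simplices_one ha hb hc h1)]

/-! ### Links -/

theorem link_empty (X : FinComplex V) : X.link ∅ = X := by
  cases X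
  simp only [link, mk.injEq]
  ext σ
  simp

theorem mem_link {τ σ : Finset V} :
    σ ∈ (X.link τ).faces ↔ σ ∈ X.faces ∧ Disjoint τ σ ∧ τ ∪ σ ∈ X.faces := by
  simp [link]

theorem link_link {a τ : Finset V} (hτ : τ ∈ (X.link a).faces) :
    (X.link a).link τ = X.link (a ∪ τ) := by
  have h : ∀ σ, σ ∈ ((X.link a).link τ).faces ↔ σ ∈ (X.link (a ∪ τ)).faces := by
    intro σ
    simp only [mem_link, Finset.disjoint_union_left, Finset.disjoint_union_right,
      Finset.union_assoc] at hτ ⊢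
    constructor
    · rintro ⟨⟨h1, h2, -⟩, h3, h4, -, h5⟩
      exact ⟨h1, ⟨h2, h3⟩, h5⟩
    · rintro ⟨h1, ⟨h2, h3⟩, h4⟩
      refine ⟨⟨h1, h2, X.down_closed _ h4 _ ?_⟩, h3, X.down_closed _ h4 _ ?_, ⟨hτ.2.1, h2⟩, h4⟩
      · exact Finset.union_subset_union_right Finset.subset_union_right
      · exact Finset.subset_union_right
  have h' := Finset.ext h
  revert h'
  generalize (X.link a).link τ = Y
  generalize X.link (a ∪ τ) = Z
  cases Y; cases Z
  simp

theorem linkWeight_linkWeight (m : Finset V → ℝ) (a τ : Finset V) :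
    linkWeight (linkWeight m a) τ = linkWeight m (a ∪ τ) := by
  funext σ
  simp [linkWeight, Finset.union_assoc]

theorem mem_simplices_link {j k : ℤ} {τ σ : Finset V} (hτ : τ ∈ X.simplices j) :
    σ ∈ (X.link τ).simplices k ↔ (σ.card : ℤ) = k + 1 ∧ τ ∪ σ ∈ X.simplices (j + k + 1) := by
  rw [mem_simplices] at hτ
  rw [mem_simplices, mem_simplices, mem_link]
  constructor
  · rintro ⟨⟨-, h2, h3⟩, h4⟩
    refine ⟨h4, h3, ?_⟩
    rw [Finset.card_union_of_disjoint h2]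
    push_cast
    omega
  · rintro ⟨h1, h2, h3⟩
    refine ⟨⟨X.down_closed _ h2 _ Finset.subset_union_right, ?_, h2⟩, h1⟩
    rw [← Finset.card_union_eq_card_add_card]
    omega

theorem mem_vertices_link {a c : Finset V} (hc : c ∈ X.simplices 0) :
    a ∈ (X.link c).simplices 0 ↔ a ∈ X.simplices 0 ∧ c ∪ a ∈ X.simplices 1 := by
  rw [mem_simplices_link hc, mem_simplices (σ := a)]
  constructor
  · rintro ⟨h1, h2⟩
    exact ⟨⟨X.down_closed _ (mem_simplices.mp h2).1 _ Finset.subset_union_right, h1⟩, h2⟩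
  · rintro ⟨h1, h2⟩
    exact ⟨h1.2, h2⟩

theorem edgeWeight_link {a b c : Finset V} (ha : a ∈ X.simplices 0) (hb : b ∈ X.simplices 0)
    (hc : c ∈ X.simplices 0) :
    (X.link c).edgeWeight (linkWeight m c) a b = X.triangleWeight m c a b := by
  have h : a ∪ b ∈ (X.link c).simplices 1 ↔ c ∪ (a ∪ b) ∈ X.simplices 2 := by
    rw [mem_simplices_link hc]
    constructor
    · exact fun h => h.2
    · exact fun h => ⟨(mem_simplices.mp (union_mem_simplices_one ha hb hc h)).2, h⟩
  simp only [edgeWeight, triangleWeight, linkWeight, h]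

theorem IsWeight.link (hm : X.IsWeight (n + 1) m) {a : Finset V} (ha : a ∈ X.simplices 0) :
    (X.link a).IsWeight n (linkWeight m a) := by
  refine ⟨fun σ hσ => hm.1 _ (mem_link.mp hσ).2.2, fun k hk hkn τ hτ => ?_⟩
  have hτ' := (mem_simplices_link ha).mp hτ
  have hd := (mem_link.mp (mem_simplices.mp hτ).1).2.1
  rw [linkWeight, hm.2 (0 + k + 1) (by omega) (by push_cast; omega) _ hτ'.2]
  refine Finset.sum_nbij' (fun ρ => ρ \ a) (fun σ => a ∪ σ) ?_ ?_ ?_ ?_ ?_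
  · intro ρ hρ
    rw [Finset.mem_filter] at hρ ⊢
    have h1 : a ⊆ ρ := Finset.subset_union_left.trans hρ.2
    refine ⟨(mem_simplices_link ha).mpr ⟨?_, ?_⟩, ?_⟩
    · have h2 := Finset.card_sdiff_add_card_eq_card h1
      have h3 := mem_simplices.mp hρ.1
      have h4 := mem_simplices.mp ha
      omega
    · rw [Finset.union_sdiff_of_subset h1]
      convert hρ.1 using 2
      ring
    · exact Finset.subset_sdiff.mpr ⟨Finset.subset_union_right.trans hρ.2, hd.symm⟩
  · intro σ hσ
    rw [Finset.mem_filter] at hσ ⊢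
    refine ⟨?_, Finset.union_subset_union_right hσ.2⟩
    convert ((mem_simplices_link ha).mp hσ.1).2 using 2
    ring
  · intro ρ hρ
    rw [Finset.mem_filter] at hρ
    exact Finset.union_sdiff_of_subset (Finset.subset_union_left.trans hρ.2)
  · intro σ hσ
    rw [Finset.mem_filter] at hσ
    have h1 := (mem_link.mp (mem_simplices.mp hσ.1).1).2.1
    rw [Finset.union_sdiff_left, Finset.sdiff_eq_self_of_disjoint h1.symm]
  · intro ρ hρ
    rw [Finset.mem_filter] at hρ
    rw [linkWeight, Finset.union_sdiff_of_subset (Finset.subset_union_left.trans hρ.2)]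

/-! ### Spectral gaps -/

/-- The averaging operator `f ↦ (1 / m a) ∑ b, m (a ∪ b) f b` on the weighted 1-skeleton of `X` has
all its eigenvalues, apart from the one on constants, at most `μ`; stated as a bound on its
quadratic form, with the component along the constants split off. It is stated for functions on all
finite sets, of which only the values at the vertices matter. -/
def HasGap (X : FinComplex V) (m : Finset V → ℝ) (μ : ℝ) : Prop :=
  ∀ f : Finset V → ℝ,
    ∑ a ∈ X.simplices 0, ∑ b ∈ X.simplices 0, X.edgeWeight m a b * f a * f b ≤
      μ * ∑ a ∈ X.simplices 0, m a * f a ^ 2 +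
        (1 - μ) * (∑ a ∈ X.simplices 0, m a * f a) ^ 2 / m ∅

theorem IsConnected.empty_mem (hX : X.IsConnected) : ∅ ∈ X.faces := by
  obtain ⟨a⟩ := SimpleGraph.Connected.nonempty hX
  exact X.down_closed _ (mem_simplices.mp a.2).1 _ (Finset.empty_subset _)

/-- It suffices to bound the eigenvalues `θ < 1` of the averaging operator. -/
theorem hasGap_of_eigenvalue_le (hX : X.IsConnected) (hm : X.IsWeight n m) (hn : 1 ≤ n) {μ : ℝ}
    (hμ : ∀ θ < 1, ∀ f : Finset V → ℝ, (∃ a ∈ X.simplices 0, f a ≠ 0) →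
      (∀ a ∈ X.simplices 0, ∑ b ∈ X.simplices 0, X.edgeWeight m a b * f b = θ * m a * f a) →
      θ ≤ μ) : X.HasGap m μ := by
  intro f
  have key := rayleigh_le_of_eigenvalue_le X.skeletonGraph hX (fun a => m a)
    (fun a => hm.pos a.2) (fun a b => X.edgeWeight m a b) (fun a b => edgeWeight_comm _ _)
    (fun a b => edgeWeight_nonneg hm _ _) ?_ ?_ μ ?_ (fun a => f a)
  · rw [← hm.sum_vertices hX.empty_mem]
    simpa only [← Finset.sum_coe_sort (X.simplices 0)] using key
  · intro a b hab
    have hab : (a : Finset V) ∪ b ∈ X.simplices 1 := hab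
    rw [edgeWeight, if_pos hab]
    exact hm.pos hab
  · intro a
    rw [← hm.sum_edgeWeight hn a.2, ← Finset.sum_coe_sort (X.simplices 0)]
  · intro θ hθ g hg hgθ
    let f' : Finset V → ℝ := fun a => if h : a ∈ X.simplices 0 then g ⟨a, h⟩ else 0
    have hf' : ∀ a : X.simplices 0, f' a = g a := fun a => dif_pos a.2
    refine hμ θ hθ f' ?_ ?_
    · obtain ⟨a, ha⟩ := Function.ne_iff.mp hg
      exact ⟨a, a.2, by rwa [hf']⟩
    · intro a ha
      have := hgθ ⟨a, ha⟩
      rw [← Finset.sum_coe_sort (X.simplices 0)]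
      simp only [hf']
      rw [this, ← hf']

theorem hasGap_of_le_spectralGap (hX : X.IsConnected) (hm : X.IsWeight n m) (hn : 1 ≤ n) {l : ℝ}
    (hl : l ≤ X.spectralGap m) : X.HasGap m (1 - l) := by
  refine hasGap_of_eigenvalue_le hX hm hn fun θ hθ f ⟨a, ha, hfa⟩ hf => ?_
  have h1 : Module.End.HasEigenvalue (X.laplacian m) (1 - θ) := by
    refine Module.End.hasEigenvalue_of_hasEigenvector (x := fun a => f a) ⟨?_, ?_⟩
    · rw [Module.End.mem_eigenspace_iff]
      funext b
      have h2 := hf b b.2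
      have h3 := (hm.pos b.2).ne'
      have h4 : ∑ u : X.simplices 0 with u.1 ∪ b.1 ∈ X.simplices 1, m (u.1 ∪ b.1) * f u =
          θ * m b * f b := by
        rw [← h2, ← Finset.sum_coe_sort (X.simplices 0), Finset.sum_filter]
        refine Finset.sum_congr rfl fun u _ => ?_
        rw [edgeWeight, Finset.union_comm]
        split_ifs <;> simp
      simp only [laplacian, LinearMap.coe_mk, AddHom.coe_mk, h4, Pi.smul_apply, smul_eq_mul]
      field_simp
    · intro h0
      exact hfa (congrFun h0 ⟨a, ha⟩)
  have h2 : X.spectralGap m ≤ 1 - θ :=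
    csInf_le ⟨0, fun μ hμ => hμ.1.le⟩ ⟨by linarith, h1⟩
  linarith

/-- The gap inequality of the link of a vertex, in terms of `X`. -/
theorem HasGap.link {c : Finset V} {μ : ℝ} (hc : c ∈ X.simplices 0)
    (h : (X.link c).HasGap (linkWeight m c) μ) (f : Finset V → ℝ) :
    ∑ a ∈ X.simplices 0, ∑ b ∈ X.simplices 0, X.triangleWeight m c a b * f a * f b ≤
      μ * ∑ a ∈ X.simplices 0, X.edgeWeight m c a * f a ^ 2 +
        (1 - μ) * (∑ a ∈ X.simplices 0, X.edgeWeight m c a * f a) ^ 2 / m c := by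
  have hsub : (X.link c).simplices 0 ⊆ X.simplices 0 :=
    fun a ha => ((mem_vertices_link hc).mp ha).1
  have hsum : ∀ g : Finset V → ℝ, ∑ a ∈ (X.link c).simplices 0, linkWeight m c a * g a =
      ∑ a ∈ X.simplices 0, X.edgeWeight m c a * g a := by
    intro g
    refine Finset.sum_subset_zero_on_sdiff hsub (fun a ha => ?_) fun a ha => ?_
    · rw [Finset.mem_sdiff, mem_vertices_link hc] at ha
      rw [edgeWeight, if_neg (by tauto), zero_mul]
    · rw [edgeWeight, if_pos ((mem_vertices_link hc).mp ha).2, linkWeight]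
  have hzero : ∀ a ∈ X.simplices 0 \ (X.link c).simplices 0, ∀ b ∈ X.simplices 0,
      X.triangleWeight m c a b = 0 := by
    intro a ha b hb
    rw [Finset.mem_sdiff, mem_vertices_link hc] at ha
    rw [triangleWeight, if_neg fun h1 => ha.2 ⟨ha.1, union_mem_simplices_one hc ha.1 hb ?_⟩]
    rwa [Finset.union_comm, Finset.union_assoc]
  have h1 := h f
  rw [hsum, hsum] at h1
  have h2 : ∑ a ∈ (X.link c).simplices 0, ∑ b ∈ (X.link c).simplices 0,
      (X.link c).edgeWeight (linkWeight m c) a b * f a * f b =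
      ∑ a ∈ X.simplices 0, ∑ b ∈ X.simplices 0, X.triangleWeight m c a b * f a * f b := by
    refine Finset.sum_subset_zero_on_sdiff hsub (fun a ha => ?_) fun a ha => ?_
    · exact Finset.sum_eq_zero fun b hb => by rw [hzero a ha b hb]; ring
    · refine Finset.sum_subset_zero_on_sdiff hsub (fun b hb => ?_) fun b hb => ?_
      · rw [triangleWeight_swap, hzero b hb a (hsub ha)]; ring
      · rw [edgeWeight_link (hsub ha) (hsub hb) hc]
  rw [h2] at h1
  simpa [linkWeight] using h1

/-- **Trickling down.** If all links of vertices have gap `μ`, an eigenvalue `θ` of the averaging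
operator satisfies `θ ≤ μ + (1 - μ) θ²`, that is, `θ ≥ 1` or `θ ≤ μ / (1 - μ)`. -/
theorem hasGap_of_link (hX : X.IsConnected) (hm : X.IsWeight n m) (hn : 2 ≤ n) {μ : ℝ}
    (hμ : μ < 1) (h : ∀ c ∈ X.simplices 0, (X.link c).HasGap (linkWeight m c) μ) :
    X.HasGap m (μ / (1 - μ)) := by
  refine hasGap_of_eigenvalue_le hX hm (by omega) fun θ hθ f ⟨a₀, ha₀, hfa⟩ hf => ?_
  set N := ∑ a ∈ X.simplices 0, m a * f a ^ 2 with hN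
  have hNpos : 0 < N := by
    refine Finset.sum_pos' (fun a ha => mul_nonneg (hm.pos ha).le (sq_nonneg _)) ⟨a₀, ha₀, ?_⟩
    have := hm.pos ha₀
    positivity
  have h1 := Finset.sum_le_sum fun c hc => (h c hc).link hc f
  have h2 : ∑ c ∈ X.simplices 0, ∑ a ∈ X.simplices 0, ∑ b ∈ X.simplices 0,
      X.triangleWeight m c a b * f a * f b = θ * N := by
    rw [Finset.sum_comm, hN, Finset.mul_sum]
    refine Finset.sum_congr rfl fun a ha => ?_
    rw [Finset.sum_comm]
    calc _ = f a * ∑ b ∈ X.simplices 0, X.edgeWeight m a b * f b := by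
          rw [Finset.mul_sum]
          refine Finset.sum_congr rfl fun b hb => ?_
          rw [← hm.sum_triangleWeight hn ha hb]
          simp only [Finset.sum_mul, Finset.mul_sum]
          exact Finset.sum_congr rfl fun c _ => by ring
      _ = _ := by rw [hf a ha]; ring
  have h3 : ∑ c ∈ X.simplices 0, ∑ a ∈ X.simplices 0, X.edgeWeight m c a * f a ^ 2 = N := by
    rw [Finset.sum_comm, hN]
    refine Finset.sum_congr rfl fun a ha => ?_
    rw [← hm.sum_edgeWeight (by omega) ha, Finset.sum_mul]
    exact Finset.sum_congr rfl fun c _ => by rw [edgeWeight_comm]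
  have h4 : ∑ c ∈ X.simplices 0,
      (1 - μ) * (∑ a ∈ X.simplices 0, X.edgeWeight m c a * f a) ^ 2 / m c =
      (1 - μ) * θ ^ 2 * N := by
    rw [hN, Finset.mul_sum]
    refine Finset.sum_congr rfl fun c hc => ?_
    rw [hf c hc]
    have := (hm.pos hc).ne'
    field_simp
  rw [h2, Finset.sum_add_distrib, h4, ← Finset.mul_sum, h3] at h1
  have h5 : θ ≤ μ + (1 - μ) * θ ^ 2 := by
    refine le_of_mul_le_mul_right ?_ hNpos
    linarith
  rw [le_div_iff₀ (by linarith)]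
  by_contra! h6
  nlinarith [mul_pos (sub_pos.mpr hθ) (sub_pos.mpr h6)]

/-- Local spectral expansion of a weighted complex of dimension `d + 1`, in the form in which it is
inherited by the links of vertices: all links of dimension at least `1` are connected, and those of
dimension `1` have spectral gap at least `l`. -/
structure LocallyExpands (X : FinComplex V) (m : Finset V → ℝ) (d : ℕ) (l : ℝ) : Prop where
  isWeight : X.IsWeight (d + 1) m
  isConnected : X.IsConnected
  isConnected_link : ∀ j : ℤ, 0 ≤ j → j ≤ d - 1 → ∀ τ ∈ X.simplices j, (X.link τ).IsConnected
  le_spectralGap : ∀ τ ∈ X.simplices (d - 1), l ≤ (X.link τ).spectralGap (linkWeight m τ)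

theorem LocallyExpands.link {d : ℕ} {l : ℝ} (h : X.LocallyExpands m (d + 1) l) {c : Finset V}
    (hc : c ∈ X.simplices 0) : (X.link c).LocallyExpands (linkWeight m c) d l := by
  have hlink : ∀ j : ℤ, ∀ τ ∈ (X.link c).simplices j, c ∪ τ ∈ X.simplices (j + 1) ∧
      (X.link c).link τ = X.link (c ∪ τ) := fun j τ hτ => by
    refine ⟨?_, link_link (mem_simplices.mp hτ).1⟩
    convert ((mem_simplices_link hc).mp hτ).2 using 2
    ring
  refine ⟨h.isWeight.link hc, h.isConnected_link 0 le_rfl (by push_cast; omega) c hc,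
    fun j hj hjd τ hτ => ?_, fun τ hτ => ?_⟩
  · rw [(hlink j τ hτ).2]
    exact h.isConnected_link (j + 1) (by omega) (by push_cast; omega) _ (hlink j τ hτ).1
  · rw [(hlink _ τ hτ).2, linkWeight_linkWeight]
    refine h.le_spectralGap _ ?_
    convert (hlink _ τ hτ).1 using 2
    push_cast
    ring

/-- The bound `1 / K` for the one-dimensional links becomes the bound `1 / (K - d)` for a complex of
dimension `d + 1`, by trickling down `d` times: `x ↦ x / (1 - x)` takes `1 / y` to
`1 / (y - 1)`. -/
theorem LocallyExpands.hasGap {K : ℝ} {d : ℕ} (hK : d < K)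
    (h : X.LocallyExpands m d (1 - 1 / K)) : X.HasGap m (1 / (K - d)) := by
  induction d generalizing X m with
  | zero =>
    have h1 := h.le_spectralGap ∅ (mem_simplices.mpr ⟨h.isConnected.empty_mem, by simp⟩)
    have h2 : linkWeight m ∅ = m := by funext σ; simp [linkWeight]
    rw [link_empty, h2] at h1
    have := hasGap_of_le_spectralGap h.isConnected h.isWeight (by omega) h1
    simpa using this
  | succ d ih =>
    push_cast at hK
    have h1 : 1 / (K - (d + 1 : ℕ)) = 1 / (K - d) / (1 - 1 / (K - d)) := by
      have h2 : K - d - 1 ≠ 0 := by intro h; linarith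
      have h3 : K - d ≠ 0 := by intro h; linarith
      have h4 : 1 - 1 / (K - d) ≠ 0 := by
        rw [one_sub_div h3]; exact div_ne_zero h2 h3
      push_cast
      rw [← sub_sub]
      field_simp
    rw [h1]
    refine hasGap_of_link h.isConnected h.isWeight (by omega) ?_ fun c hc =>
      ih (by linarith) (h.link hc)
    rw [div_lt_one] <;> linarith

/-! ### Counting faces -/

/-- A simplex of dimension `k + 1` has `k + 2` facets. -/
theorem card_facets {k : ℤ} (hk : -1 ≤ k) {ρ : Finset V} (hρ : ρ ∈ X.simplices (k + 1)) :
    (({σ ∈ X.simplices k | σ ⊆ ρ} : Finset (Finset V)).card : ℤ) = k + 2 := by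
  obtain ⟨j, hj⟩ : ∃ j : ℕ, k + 1 = j := ⟨(k + 1).toNat, by omega⟩
  rw [mem_simplices] at hρ
  have h1 : ρ.card = j + 1 := by omega
  have h2 : ({σ ∈ X.simplices k | σ ⊆ ρ} : Finset (Finset V)) = ρ.powersetCard j := by
    ext σ
    rw [Finset.mem_filter, mem_simplices, Finset.mem_powersetCard]
    constructor
    · rintro ⟨⟨-, h3⟩, h4⟩
      exact ⟨h4, by omega⟩
    · rintro ⟨h3, h4⟩
      exact ⟨⟨X.down_closed _ hρ.1 _ h3, by omega⟩, h3⟩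
  rw [h2, Finset.card_powersetCard, h1, Nat.choose_succ_self_right]
  push_cast
  omega

theorem sum_facets {k : ℤ} (hk : -1 ≤ k) (F : Finset V → ℝ) :
    ∑ σ ∈ X.simplices k, ∑ ρ ∈ X.simplices (k + 1) with σ ⊆ ρ, F ρ =
      (k + 2) * ∑ ρ ∈ X.simplices (k + 1), F ρ := by
  simp only [Finset.sum_filter]
  rw [Finset.sum_comm, Finset.mul_sum]
  refine Finset.sum_congr rfl fun ρ hρ => ?_
  rw [← Finset.sum_filter, Finset.sum_const, nsmul_eq_mul]
  congr 1
  exact_mod_cast card_facets hk hρ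

/-- Each edge is counted twice in a sum over ordered pairs of vertices. -/
theorem sum_edges (F : Finset V → ℝ) :
    ∑ a ∈ X.simplices 0, ∑ b ∈ X.simplices 0, (if a ∪ b ∈ X.simplices 1 then F (a ∪ b) else 0) =
      2 * ∑ e ∈ X.simplices 1, F e := by
  have h1 := sum_facets (X := X) (k := 0) (by omega) F
  refine (Finset.sum_congr rfl fun a ha => sum_union_vertex ha F).trans (h1.trans ?_)
  norm_num

theorem sum_edgeWeight_mul (F : Finset V → ℝ) :
    ∑ a ∈ X.simplices 0, ∑ b ∈ X.simplices 0, X.edgeWeight m a b * F (a ∪ b) =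
      2 * ∑ e ∈ X.simplices 1, m e * F e := by
  rw [← sum_edges fun e => m e * F e]
  simp only [edgeWeight, ite_mul, zero_mul]

/-- Each triangle is counted six times in a sum over ordered triples of vertices. -/
theorem sum_triangleWeight_mul (F : Finset V → ℝ) :
    ∑ c ∈ X.simplices 0, ∑ a ∈ X.simplices 0, ∑ b ∈ X.simplices 0,
      X.triangleWeight m c a b * F (c ∪ (a ∪ b)) = 6 * ∑ t ∈ X.simplices 2, m t * F t := by
  have h1 : ∀ a ∈ X.simplices 0, ∀ b ∈ X.simplices 0,
      ∑ c ∈ X.simplices 0, X.triangleWeight m c a b * F (c ∪ (a ∪ b)) =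
        if a ∪ b ∈ X.simplices 1 then
          ∑ ρ ∈ X.simplices (1 + 1) with a ∪ b ⊆ ρ, m ρ * F ρ else 0 := by
    intro a ha b hb
    split_ifs with h
    · rw [← sum_union_vertex h]
      refine Finset.sum_congr rfl fun c _ => ?_
      rw [triangleWeight, Finset.union_comm c, ite_mul, zero_mul]
      rfl
    · refine Finset.sum_eq_zero fun c hc => ?_
      rw [triangleWeight, if_neg fun h1 => h (union_mem_simplices_one ha hb hc h1), zero_mul]
  have h2 := sum_facets (X := X) (k := 1) (by omega) fun ρ => m ρ * F ρ
  have h3 := sum_edges (X := X) fun e => ∑ ρ ∈ X.simplices (1 + 1) with e ⊆ ρ, m ρ * F ρ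
  rw [h2] at h3
  rw [Finset.sum_comm]
  calc _ = ∑ a ∈ X.simplices 0, ∑ b ∈ X.simplices 0, _ :=
        Finset.sum_congr rfl fun a ha => by
          rw [Finset.sum_comm]
          exact Finset.sum_congr rfl fun b hb => h1 a ha b hb
    _ = 2 * ((((1 : ℤ) : ℝ) + 2) * ∑ ρ ∈ X.simplices 2, m ρ * F ρ) := h3
    _ = _ := by push_cast; ring

theorem sum_triangleWeight_rotate (G : Finset V → Finset V → Finset V → ℝ) :
    ∑ c ∈ X.simplices 0, ∑ a ∈ X.simplices 0, ∑ b ∈ X.simplices 0,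
      X.triangleWeight m c a b * G a b c =
    ∑ c ∈ X.simplices 0, ∑ a ∈ X.simplices 0, ∑ b ∈ X.simplices 0,
      X.triangleWeight m c a b * G c a b := by
  rw [Finset.sum_comm]
  refine Finset.sum_congr rfl fun a _ => ?_
  rw [Finset.sum_comm]
  refine Finset.sum_congr rfl fun b _ => Finset.sum_congr rfl fun c _ => ?_
  rw [triangleWeight_rotate]

theorem IsWeight.two_mul_totalWeight (hm : X.IsWeight n m) (hn : 1 ≤ n) (h0 : ∅ ∈ X.faces) :
    2 * X.totalWeight m 1 = m ∅ := by
  rw [← hm.sum_vertices h0, totalWeight, ← sum_edges]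
  exact Finset.sum_congr rfl fun a ha => hm.sum_edgeWeight hn ha

/-! ### Cochains as functions on finite sets -/

/-- The extension of a cochain by zero to all finite sets. -/
def extend {k : ℤ} (φ : X.Cochain k) (σ : Finset V) : ZMod 2 :=
  if h : σ ∈ X.simplices k then φ ⟨σ, h⟩ else 0

/-- The real indicator function of the support of a cochain, on all finite sets. -/
noncomputable def indicator {k : ℤ} (φ : X.Cochain k) (σ : Finset V) : ℝ :=
  if extend φ σ = 1 then 1 else 0

theorem extend_apply {k : ℤ} (φ : X.Cochain k) (σ : X.simplices k) : extend φ σ = φ σ :=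
  dif_pos σ.2

theorem indicator_nonneg {k : ℤ} (φ : X.Cochain k) (σ : Finset V) : 0 ≤ indicator φ σ := by
  unfold indicator; split_ifs <;> norm_num

theorem indicator_le_one {k : ℤ} (φ : X.Cochain k) (σ : Finset V) : indicator φ σ ≤ 1 := by
  unfold indicator; split_ifs <;> norm_num

theorem indicator_sq {k : ℤ} (φ : X.Cochain k) (σ : Finset V) :
    indicator φ σ ^ 2 = indicator φ σ := by
  unfold indicator; split_ifs <;> norm_num

theorem cochainNorm_eq_sum {k : ℤ} (φ : X.Cochain k) :
    X.cochainNorm m φ = ∑ σ ∈ X.simplices k, m σ * indicator φ σ := by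
  rw [cochainNorm, Finset.sum_filter, ← Finset.sum_coe_sort (X.simplices k)]
  refine Finset.sum_congr rfl fun σ _ => ?_
  rw [indicator, extend_apply, mul_ite, mul_one, mul_zero]

theorem cochainNorm_pos (hm : X.IsWeight n m) {k : ℤ} {φ : X.Cochain k} {σ : X.simplices k}
    (hσ : φ σ = 1) : 0 < X.cochainNorm m φ :=
  Finset.sum_pos (fun τ _ => hm.pos τ.2) ⟨σ, by simpa using hσ⟩

theorem exists_eq_one_of_ne_zero {U : Type*} {Y : FinComplex U} {k : ℤ} {φ : Y.Cochain k}
    (hφ : φ ≠ 0) : ∃ σ, φ σ = 1 := by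
  obtain ⟨σ, hσ⟩ := Function.ne_iff.mp hφ
  have h : ∀ x : ZMod 2, x ≠ 0 → x = 1 := by decide
  exact ⟨σ, h _ hσ⟩

theorem coboundary_apply {k l : ℤ} (φ : X.Cochain k) (σ : X.simplices l) :
    X.coboundary k l φ σ = ∑ τ ∈ X.simplices k with τ ⊆ σ.1, extend φ τ := by
  rw [coboundary, Finset.sum_filter, ← Finset.sum_coe_sort (X.simplices k)]
  exact Finset.sum_congr rfl fun τ _ => by rw [extend_apply]

theorem coboundary_edge (φ : X.Cochain 0) {a b : X.simplices 0}
    (h : (a : Finset V) ∪ b ∈ X.simplices 1) : X.coboundary 0 1 φ ⟨a ∪ b, h⟩ = φ a + φ b := by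
  have hab : (a : Finset V) ≠ b := fun h1 => by
    rw [h1, Finset.union_self, mem_simplices] at h
    have := (mem_simplices.mp b.2).2
    omega
  have h1 : ({τ ∈ X.simplices 0 | τ ⊆ (a : Finset V) ∪ b} : Finset (Finset V)) =
      {(a : Finset V), (b : Finset V)} := by
    refine (Finset.eq_of_subset_of_card_le ?_ ?_).symm
    · intro τ hτ
      rw [Finset.mem_insert, Finset.mem_singleton] at hτ
      rw [Finset.mem_filter]
      rcases hτ with rfl | rfl
      · exact ⟨a.2, Finset.subset_union_left⟩
      · exact ⟨b.2, Finset.subset_union_right⟩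
    · have := card_facets (X := X) (k := 0) (by omega) h
      rw [Finset.card_pair hab]
      omega
  rw [coboundary_apply, h1, Finset.sum_pair hab, extend_apply, extend_apply]

theorem coboundary_triangle (φ : X.Cochain 1) {a b c : Finset V} (ha : a ∈ X.simplices 0)
    (hb : b ∈ X.simplices 0) (hc : c ∈ X.simplices 0) (h : c ∪ (a ∪ b) ∈ X.simplices 2) :
    X.coboundary 1 2 φ ⟨c ∪ (a ∪ b), h⟩ =
      extend φ (c ∪ a) + extend φ (c ∪ b) + extend φ (a ∪ b) := by
  have e1 : a ∪ (b ∪ c) = c ∪ (a ∪ b) := by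
    rw [Finset.union_comm c, Finset.union_assoc]
  have e2 : b ∪ (c ∪ a) = c ∪ (a ∪ b) := by
    rw [← e1, ← Finset.union_assoc, Finset.union_comm]
  have hab := union_mem_simplices_one ha hb hc h
  have hca := union_mem_simplices_one hc ha hb (e2 ▸ h)
  have hcb : c ∪ b ∈ X.simplices 1 := by
    rw [Finset.union_comm]
    exact union_mem_simplices_one hb hc ha (e1 ▸ h)
  have hcard : ∀ e ∈ X.simplices 1, c ∪ (a ∪ b) ⊆ e → False := fun e he hsub => by
    have h1 := Finset.card_le_card hsub
    have h2 := (mem_simplices.mp he).2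
    have h3 := (mem_simplices.mp h).2
    omega
  have n1 : c ∪ a ≠ c ∪ b := fun h1 => hcard _ hcb (by
    refine Finset.union_subset Finset.subset_union_left
      (Finset.union_subset ?_ Finset.subset_union_right)
    rw [← h1]; exact Finset.subset_union_right)
  have n2 : c ∪ a ≠ a ∪ b := fun h1 => hcard _ hab (by
    refine Finset.union_subset ?_ subset_rfl
    rw [← h1]; exact Finset.subset_union_left)
  have n3 : c ∪ b ≠ a ∪ b := fun h1 => hcard _ hab (by
    refine Finset.union_subset ?_ subset_rfl
    rw [← h1]; exact Finset.subset_union_left)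
  have h3 : ({c ∪ a, c ∪ b, a ∪ b} : Finset (Finset V)).card = 3 :=
    Finset.card_eq_three.mpr ⟨_, _, _, n1, n2, n3, rfl⟩
  have h1 : ({τ ∈ X.simplices 1 | τ ⊆ c ∪ (a ∪ b)} : Finset (Finset V)) =
      {c ∪ a, c ∪ b, a ∪ b} := by
    refine (Finset.eq_of_subset_of_card_le ?_ ?_).symm
    · intro τ hτ
      simp only [Finset.mem_insert, Finset.mem_singleton] at hτ
      rw [Finset.mem_filter]
      rcases hτ with rfl | rfl | rfl
      · exact ⟨hca, Finset.union_subset_union_right Finset.subset_union_left⟩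
      · exact ⟨hcb, Finset.union_subset_union_right Finset.subset_union_right⟩
      · exact ⟨hab, Finset.subset_union_right⟩
    · have := card_facets (X := X) (k := 1) (by omega) h
      omega
  rw [coboundary_apply, h1, Finset.sum_insert (by simp [n1, n2]), Finset.sum_pair n3, add_assoc]

/-! ### Cochains of degree zero -/

/-- The norm bound excludes the constant cochain `1`, so `φ` takes both values, and it changes along
some edge because `X` is connected. -/
theorem cochainNorm_coboundary_pos (hX : X.IsConnected) (hm : X.IsWeight n m) {φ : X.Cochain 0}
    (hφ : φ ≠ 0) {ε : ℝ} (hε : ε < 1)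
    (hmin : X.cochainNorm m φ ≤ (1 + ε) * X.totalWeight m 0 / 2) :
    0 < X.cochainNorm m (X.coboundary 0 1 φ) := by
  obtain ⟨a, ha⟩ := exists_eq_one_of_ne_zero hφ
  by_cases hadj : ∀ u v : X.simplices 0, X.skeletonGraph.Adj u v → φ u = φ v
  · exfalso
    have hone : ∀ b, φ b = 1 := fun b => by
      obtain ⟨p⟩ := SimpleGraph.Connected.preconnected hX b a
      induction p with
      | nil => exact ha
      | cons h _ ih => exact (hadj _ _ h).trans (ih ha)
    have h1 : X.cochainNorm m φ = X.totalWeight m 0 := by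
      rw [cochainNorm, Finset.filter_true_of_mem fun b _ => hone b, totalWeight,
        ← Finset.sum_coe_sort (X.simplices 0)]
    have h2 := cochainNorm_pos hm ha
    rw [h1] at h2 hmin
    nlinarith
  · push Not at hadj
    obtain ⟨u, v, huv, hne⟩ := hadj
    have huv : (u : Finset V) ∪ v ∈ X.simplices 1 := huv
    refine cochainNorm_pos hm (σ := ⟨u ∪ v, huv⟩) ?_
    rw [coboundary_edge]
    revert hne
    generalize φ u = x
    generalize φ v = y
    revert x y
    decide

/-! ### Cochains of degree one -/

/-- The weight of the localization of `φ` at the vertex `c`, in its link. -/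
noncomputable def localNorm (m : Finset V → ℝ) (φ : X.Cochain 1) (c : Finset V) : ℝ :=
  ∑ a ∈ X.simplices 0, X.edgeWeight m c a * indicator φ (c ∪ a)

theorem localNorm_nonneg (hm : X.IsWeight n m) (φ : X.Cochain 1) (c : Finset V) :
    0 ≤ localNorm m φ c :=
  Finset.sum_nonneg fun _ _ => mul_nonneg (edgeWeight_nonneg hm _ _) (indicator_nonneg _ _)

theorem sum_localNorm (φ : X.Cochain 1) :
    ∑ c ∈ X.simplices 0, localNorm m φ c = 2 * X.cochainNorm m φ := by
  rw [cochainNorm_eq_sum, ← sum_edgeWeight_mul]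
  rfl

/-- Local minimality at a vertex, against the coboundary that is constantly `1`: the localization
takes up little more than half of the link. -/
theorem IsEpsLocallyMinimal.localNorm_le (hm : X.IsWeight n m) (hn : 1 ≤ n) {ε : ℝ}
    {φ : X.Cochain 1} (hφ : X.IsEpsLocallyMinimal m ε φ) {c : Finset V}
    (hc : c ∈ X.simplices 0) : 2 * localNorm m φ c ≤ (1 + ε) * m c := by
  have hψ : (1 : (X.link c).Cochain (1 - 0 - 1)) ∈ (X.link c).coboundaries (1 - 0 - 1) := by
    refine ⟨1, ?_⟩
    funext σ
    have hempty : ∅ ∈ (X.link c).simplices (1 - 0 - 1 - 1) := mem_simplices.mpr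
      ⟨(X.link c).down_closed _ (mem_simplices.mp σ.2).1 _ (Finset.empty_subset _), by simp⟩
    rw [coboundary, Finset.sum_eq_single ⟨∅, hempty⟩]
    · simp
    · intro τ _ hτ
      refine absurd (Subtype.ext ?_) hτ
      have := (mem_simplices.mp τ.2).2
      exact Finset.card_eq_zero.mp (by omega)
    · simp
  have h1 := hφ.2 le_rfl 0 le_rfl (by omega) c hc 1 hψ
  have h2 : (X.link c).cochainNorm (linkWeight m c) (localization hc φ) = localNorm m φ c := by
    have hsub : (X.link c).simplices 0 ⊆ X.simplices 0 :=
      fun a ha => ((mem_vertices_link hc).mp ha).1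
    rw [cochainNorm_eq_sum, localNorm]
    refine Finset.sum_subset_zero_on_sdiff hsub (fun a ha => ?_) fun a ha => ?_
    · replace ha : a ∈ X.simplices 0 \ (X.link c).simplices 0 := ha
      rw [Finset.mem_sdiff, mem_vertices_link hc] at ha
      rw [edgeWeight, if_neg (by tauto), zero_mul]
    · have h3 := ((mem_vertices_link hc).mp ha).2
      rw [edgeWeight, if_pos h3, linkWeight, indicator, indicator,
        extend_apply (localization hc φ) ⟨a, ha⟩, extend_apply φ ⟨c ∪ a, h3⟩]
      rfl
  have h3 : (X.link c).cochainNorm (linkWeight m c) (localization hc φ) +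
      (X.link c).cochainNorm (linkWeight m c) (localization hc φ - 1) = m c := by
    have h4 : ∀ x : ZMod 2, x - 1 = 1 ↔ ¬ x = 1 := by decide
    simp only [cochainNorm, Pi.sub_apply, Pi.one_apply, h4]
    rw [Finset.sum_filter_add_sum_filter_not, ← hm.sum_edgeWeight hn hc]
    simp only [edgeWeight]
    rw [← Finset.sum_filter]
    have h5 : (X.link c).simplices (1 - 0 - 1) =
        (X.simplices 0).filter fun b => c ∪ b ∈ X.simplices 1 := by
      ext a
      rw [Finset.mem_filter]
      exact mem_vertices_link hc
    rw [← h5, ← Finset.sum_coe_sort ((X.link c).simplices (1 - 0 - 1))]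
    rfl
  linarith

/-- A sum over the paths of length two in the support of `φ`, of the weight of the triangle which
they span. -/
noncomputable def pathSum (m : Finset V → ℝ) (φ : X.Cochain 1) : ℝ :=
  ∑ c ∈ X.simplices 0, ∑ a ∈ X.simplices 0, ∑ b ∈ X.simplices 0,
    X.triangleWeight m c a b * (indicator φ (c ∪ a) * indicator φ (c ∪ b))

/-- If `t i` is the weight of the triangles with `i` edges in the support of `φ`, then `‖φ‖` is
`t 1 + 2 t 2 + 3 t 3`, the path sum is `2 t 2 + 6 t 3`, and `‖dφ‖` is `t 1 + t 3`. -/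
theorem cochainNorm_sub_pathSum_le (hm : X.IsWeight n m) (hn : 2 ≤ n) (φ : X.Cochain 1) :
    X.cochainNorm m φ - pathSum m φ ≤ X.cochainNorm m (X.coboundary 1 2 φ) := by
  set s := indicator φ
  set W := X.triangleWeight m
  have hpoint : ∀ c ∈ X.simplices 0, ∀ a ∈ X.simplices 0, ∀ b ∈ X.simplices 0,
      W c a b * s (a ∪ b) + W c a b * s (b ∪ c) + W c a b * s (c ∪ a) -
        2 * (W c a b * (s (c ∪ a) * s (c ∪ b)) + W c a b * (s (a ∪ b) * s (a ∪ c)) +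
          W c a b * (s (b ∪ c) * s (b ∪ a))) ≤
      W c a b * indicator (X.coboundary 1 2 φ) (c ∪ (a ∪ b)) := by
    intro c hc a ha b hb
    by_cases h : c ∪ (a ∪ b) ∈ X.simplices 2
    · have h1 : s (a ∪ b) + s (b ∪ c) + s (c ∪ a) - 2 * (s (c ∪ a) * s (c ∪ b) +
          s (a ∪ b) * s (a ∪ c) + s (b ∪ c) * s (b ∪ a)) ≤
          indicator (X.coboundary 1 2 φ) (c ∪ (a ∪ b)) := by
        rw [Finset.union_comm b c, Finset.union_comm b a, Finset.union_comm a c]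
        simp only [s, indicator]
        rw [extend_apply _ ⟨c ∪ (a ∪ b), h⟩, coboundary_triangle φ ha hb hc h]
        have h01 : ∀ x : ZMod 2, x = 0 ∨ x = 1 := by decide
        have h2 : (2 : ZMod 2) ≠ 1 := by decide
        rcases h01 (extend φ (c ∪ a)) with hx | hx <;>
          rcases h01 (extend φ (c ∪ b)) with hy | hy <;>
          rcases h01 (extend φ (a ∪ b)) with hz | hz <;>
          rw [hx, hy, hz] <;> norm_num [h2]
        -- three edges in the support: `-3` is below either value of the indicator
        split_ifs <;> norm_num
      have := mul_le_mul_of_nonneg_left h1 (triangleWeight_nonneg hm c a b)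
      linarith
    · have h0 : W c a b = 0 := if_neg h
      simp [h0]
  have hsum := Finset.sum_le_sum fun c hc => Finset.sum_le_sum fun a ha =>
    Finset.sum_le_sum fun b hb => hpoint c hc a ha b hb
  simp only [Finset.sum_add_distrib, Finset.sum_sub_distrib, ← Finset.mul_sum] at hsum
  have e1 : ∑ c ∈ X.simplices 0, ∑ a ∈ X.simplices 0, ∑ b ∈ X.simplices 0,
      W c a b * s (a ∪ b) = 2 * X.cochainNorm m φ := by
    rw [cochainNorm_eq_sum, ← sum_edgeWeight_mul, Finset.sum_comm]
    refine Finset.sum_congr rfl fun a ha => ?_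
    rw [Finset.sum_comm]
    refine Finset.sum_congr rfl fun b hb => ?_
    rw [← Finset.sum_mul, hm.sum_triangleWeight hn ha hb]
  have e2 := sum_triangleWeight_rotate (X := X) (m := m) fun _ a b => s (a ∪ b)
  have e3 := sum_triangleWeight_rotate (X := X) (m := m) fun c _ b => s (b ∪ c)
  have e4 := sum_triangleWeight_rotate (X := X) (m := m) fun c a b => s (c ∪ a) * s (c ∪ b)
  have e5 := sum_triangleWeight_rotate (X := X) (m := m) fun c a b => s (a ∪ b) * s (a ∪ c)
  have e6 := sum_triangleWeight_mul (X := X) (m := m) (indicator (X.coboundary 1 2 φ))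
  rw [← cochainNorm_eq_sum] at e6
  have e7 : pathSum m φ = ∑ c ∈ X.simplices 0, ∑ a ∈ X.simplices 0, ∑ b ∈ X.simplices 0,
    X.triangleWeight m c a b * (s (c ∪ a) * s (c ∪ b)) := rfl
  simp only [W] at hsum e1
  linarith

/-- Spectral gaps of the links bound the path sum by local norms. -/
theorem pathSum_le (hm : X.IsWeight n m) {μ : ℝ} (hμ : 0 ≤ μ)
    (h : ∀ c ∈ X.simplices 0, (X.link c).HasGap (linkWeight m c) μ) (φ : X.Cochain 1) :
    pathSum m φ ≤ 2 * μ * X.cochainNorm m φ +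
      ∑ c ∈ X.simplices 0, localNorm m φ c ^ 2 / m c := by
  have h1 : pathSum m φ ≤ ∑ c ∈ X.simplices 0,
      (μ * localNorm m φ c + localNorm m φ c ^ 2 / m c) := by
    refine Finset.sum_le_sum fun c hc => ?_
    have h2 := (h c hc).link hc fun a => indicator φ (c ∪ a)
    simp only [indicator_sq, mul_assoc] at h2
    have h3 : 0 ≤ localNorm m φ c ^ 2 / m c := div_nonneg (sq_nonneg _) (hm.pos hc).le
    have h4 : (1 - μ) * localNorm m φ c ^ 2 / m c ≤ localNorm m φ c ^ 2 / m c := by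
      rw [mul_div_assoc]
      nlinarith
    have h5 : localNorm m φ c =
      ∑ a ∈ X.simplices 0, X.edgeWeight m c a * indicator φ (c ∪ a) := rfl
    rw [← h5] at h2
    linarith
  rw [Finset.sum_add_distrib, ← Finset.mul_sum, sum_localNorm] at h1
  linarith

/-- A set `T` of vertices of small weight carries little more than half of the sum of the local
norms: an edge with only one end in `T` contributes half of what it contributes to the sum over all
vertices, and the gap of `X` makes the edges with both ends in `T` negligible. -/
theorem sum_localNorm_le (hX : X.IsConnected) (hm : X.IsWeight n m) {μ κ : ℝ} (hμ : 0 ≤ μ)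
    (h : X.HasGap m μ) (φ : X.Cochain 1) {T : Finset (Finset V)} (hT : T ⊆ X.simplices 0)
    (hκ : ∑ c ∈ T, m c ≤ κ * m ∅) :
    2 * ∑ c ∈ T, localNorm m φ c ≤ 2 * X.cochainNorm m φ + (μ + κ) * ∑ c ∈ T, m c := by
  set t : Finset V → ℝ := fun c => if c ∈ T then 1 else 0 with ht
  have ht0 : ∀ c, 0 ≤ t c := fun c => by simp only [ht]; split_ifs <;> norm_num
  have ht1 : ∀ c, t c ≤ 1 := fun c => by simp only [ht]; split_ifs <;> norm_num
  have htT : ∀ g : Finset V → ℝ, ∑ c ∈ X.simplices 0, g c * t c = ∑ c ∈ T, g c := fun g => by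
    simp only [ht, mul_ite, mul_one, mul_zero]
    rw [← Finset.sum_filter, Finset.filter_mem_eq_inter, Finset.inter_eq_right.mpr hT]
  set w : Finset V → Finset V → ℝ := fun c a => X.edgeWeight m c a * indicator φ (c ∪ a) with hw
  have hw0 : ∀ c a, 0 ≤ w c a := fun c a =>
    mul_nonneg (edgeWeight_nonneg hm _ _) (indicator_nonneg _ _)
  have hM : 0 ≤ ∑ c ∈ T, m c := Finset.sum_nonneg fun c hc => (hm.pos (hT hc)).le
  have h0 : 0 < m ∅ := hm.1 _ hX.empty_mem
  have h1 : ∑ c ∈ X.simplices 0, ∑ a ∈ X.simplices 0, w c a * t c =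
      ∑ c ∈ T, localNorm m φ c := by
    rw [← htT]
    exact Finset.sum_congr rfl fun c _ => by rw [← Finset.sum_mul]; rfl
  have h2 : ∑ c ∈ X.simplices 0, ∑ a ∈ X.simplices 0, w c a * t a =
      ∑ c ∈ T, localNorm m φ c := by
    rw [Finset.sum_comm, ← h1]
    refine Finset.sum_congr rfl fun c _ => Finset.sum_congr rfl fun a _ => ?_
    simp only [hw]
    rw [edgeWeight_comm, Finset.union_comm]
  have h3 : ∑ c ∈ X.simplices 0, ∑ a ∈ X.simplices 0, w c a = 2 * X.cochainNorm m φ :=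
    sum_localNorm φ
  have h4 : ∀ c a, w c a * t c + w c a * t a ≤ w c a + X.edgeWeight m c a * t c * t a := by
    intro c a
    have h5 : w c a * (t c + t a) ≤ w c a * (1 + t c * t a) :=
      mul_le_mul_of_nonneg_left
        (by nlinarith [mul_nonneg (sub_nonneg.mpr (ht1 c)) (sub_nonneg.mpr (ht1 a))]) (hw0 c a)
    have h6 : w c a * (t c * t a) ≤ X.edgeWeight m c a * (t c * t a) :=
      mul_le_mul_of_nonneg_right
        (mul_le_of_le_one_right (edgeWeight_nonneg hm _ _) (indicator_le_one _ _))
        (mul_nonneg (ht0 c) (ht0 a))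
    linarith
  have h5 := Finset.sum_le_sum fun c (_ : c ∈ X.simplices 0) =>
    Finset.sum_le_sum fun a (_ : a ∈ X.simplices 0) => h4 c a
  simp only [Finset.sum_add_distrib, h1, h2, h3] at h5
  have h6 := h t
  have h7 : ∀ c, t c ^ 2 = t c := fun c => by simp only [ht]; split_ifs <;> norm_num
  simp only [h7, htT m] at h6
  have h8 : (1 - μ) * (∑ c ∈ T, m c) ^ 2 / m ∅ ≤ κ * ∑ c ∈ T, m c := by
    rw [div_le_iff₀ h0]
    nlinarith [mul_nonneg hμ (sq_nonneg (∑ c ∈ T, m c)), mul_le_mul_of_nonneg_left hκ hM]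
  linarith

/-- Vertices `c` are thick when `φ` takes up more than `1 / 20` of their link. The thick vertices
have small total weight, hence carry about half of the sum `2 ‖φ‖` of the local norms, and by local
minimality their links are at most about half full. -/
theorem pathSum_le_of_small (hX : X.IsConnected) (hm : X.IsWeight n m) (hn : 2 ≤ n) {μ : ℝ}
    (hμ0 : 0 ≤ μ) (hμ : μ ≤ 1 / 2000) (hgap : X.HasGap m μ) {ν : ℝ} (hν0 : 0 ≤ ν)
    (hν : ν ≤ 1 / 2000) (hlink : ∀ c ∈ X.simplices 0, (X.link c).HasGap (linkWeight m c) ν)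
    {φ : X.Cochain 1} (hmin : X.IsEpsLocallyMinimal m (1 / 10) φ)
    (hsmall : X.cochainNorm m φ ≤ 1 / 40000 * X.totalWeight m 1) :
    pathSum m φ ≤ 3 / 4 * X.cochainNorm m φ := by
  set N := X.cochainNorm m φ with hN
  set A := localNorm m φ with hA
  have hsum : ∑ c ∈ X.simplices 0, A c = 2 * N := sum_localNorm φ
  have hA0 : ∀ c, 0 ≤ A c := localNorm_nonneg hm φ
  have hN0 : 0 ≤ N := by
    have := Finset.sum_nonneg fun c (_ : c ∈ X.simplices 0) => hA0 c
    linarith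
  set T := (X.simplices 0).filter fun c => m c < 20 * A c with hT
  have hTX : T ⊆ X.simplices 0 := Finset.filter_subset _ _
  have hmT : ∑ c ∈ T, m c ≤ 40 * N := by
    have h1 : ∑ c ∈ T, m c ≤ ∑ c ∈ T, 20 * A c :=
      Finset.sum_le_sum fun c hc => (Finset.mem_filter.mp hc).2.le
    have h2 : ∑ c ∈ T, A c ≤ ∑ c ∈ X.simplices 0, A c :=
      Finset.sum_le_sum_of_subset_of_nonneg hTX fun c _ _ => hA0 c
    rw [← Finset.mul_sum] at h1
    linarith
  have hκ : ∑ c ∈ T, m c ≤ 1 / 2000 * m ∅ := by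
    rw [← hm.two_mul_totalWeight (by omega) hX.empty_mem]
    linarith
  have h1 := sum_localNorm_le hX hm hμ0 hgap φ hTX hκ
  have h2 : (μ + 1 / 2000) * ∑ c ∈ T, m c ≤ 1 / 1000 * (40 * N) :=
    mul_le_mul (by linarith) hmT (Finset.sum_nonneg fun c hc => (hm.pos (hTX hc)).le)
      (by norm_num)
  have h3 : ∑ c ∈ X.simplices 0, A c ^ 2 / m c ≤ 1 / 20 * (2 * N) + 11 / 20 * ∑ c ∈ T, A c := by
    rw [← hsum, hT, Finset.sum_filter, Finset.mul_sum, Finset.mul_sum, ← Finset.sum_add_distrib]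
    refine Finset.sum_le_sum fun c hc => ?_
    have hmc := hm.pos hc
    rw [div_le_iff₀ hmc, sq]
    have h4 := hmin.localNorm_le hm (by omega) hc
    have h5 := hA0 c
    split_ifs with h
    · nlinarith [mul_nonneg h5 hmc.le, mul_le_mul_of_nonneg_left h4 h5]
    · nlinarith [mul_le_mul_of_nonneg_left (not_lt.mp h) h5]
  have h4 := pathSum_le hm hν0 hlink φ
  have h5 : ν * N ≤ 1 / 2000 * N := mul_le_mul_of_nonneg_right hν hN0
  linarith

end FinComplex

open FinComplex

/-! ### Expansion of locally minimal cochains -/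

theorem theorem7p10 (n : ℕ) (hn : 1 < n) :
    ∃ Λ₁ ε C₁ : ℝ, ((n : ℝ) - 1) / n < Λ₁ ∧ Λ₁ < 1 ∧ 0 < ε ∧ 0 < C₁ ∧
      ∀ (V : Type*) [DecidableEq V] (X : FinComplex V) (m : Finset V → ℝ),
        X.IsPure n → X.IsWeight n m →
        ∀ l : ℝ, X.HasLocalSpectralExpansion n m l → Λ₁ ≤ l →
          (∀ φ : X.Cochain 0, φ ≠ 0 → X.IsEpsLocallyMinimal m ε φ →
            0 < X.cochainNorm m (X.coboundary 0 1 φ)) ∧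
          (∀ φ : X.Cochain 1, φ ≠ 0 → X.IsEpsLocallyMinimal m ε φ →
            X.cochainNorm m φ ≤ C₁ * X.totalWeight m 1 →
            1 / 4 * X.cochainNorm m φ ≤ X.cochainNorm m (X.coboundary 1 2 φ) ∧
              0 < 1 / 4 * X.cochainNorm m φ) := by
  have hn0 : (1 : ℝ) < n := by exact_mod_cast hn
  have hpos : (0 : ℝ) < n := by linarith
  -- with `K = 4000 n`, the at most `n` steps of trickling down keep all gaps `1 / (K - d)` below
  -- `1 / 2000`
  refine ⟨1 - 1 / (4000 * n), 1 / 10, 1 / 40000, ?_, ?_, by norm_num, by norm_num, ?_⟩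
  · have h1 : 1 / (4000 * (n : ℝ)) < 1 / n := one_div_lt_one_div_of_lt hpos (by linarith)
    rw [sub_div, div_self hpos.ne']
    linarith
  · have : 0 < 1 / (4000 * (n : ℝ)) := by positivity
    linarith
  intro V _ X m hpure hm l hexp hl
  obtain ⟨-, -, hconn, hgap⟩ := hexp
  have hX : X.IsConnected := by
    obtain ⟨σ, hσ⟩ := hpure.1
    have h0 := X.down_closed σ hσ ∅ (Finset.empty_subset _)
    rw [← X.link_empty]
    exact hconn (-1) le_rfl (by omega) ∅ (mem_simplices.mpr ⟨h0, by simp⟩)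
  refine ⟨fun φ hφ hmin => cochainNorm_coboundary_pos hX hm hφ (by norm_num) (hmin.1 rfl),
    fun φ hφ hmin hsmall => ?_⟩
  obtain ⟨d, rfl⟩ : ∃ d, n = d + 2 := ⟨n - 2, by omega⟩
  set K : ℝ := 4000 * ((d + 2 : ℕ) : ℝ) with hK
  push_cast at hK
  have hd : (0 : ℝ) ≤ d := d.cast_nonneg
  have hsmall_gap : ∀ x : ℝ, x ≤ d + 1 → 0 ≤ 1 / (K - x) ∧ 1 / (K - x) ≤ 1 / 2000 := by
    intro x hx
    exact ⟨by apply one_div_nonneg.mpr; linarith,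
      one_div_le_one_div_of_le (by norm_num) (by linarith)⟩
  have hloc : X.LocallyExpands m (d + 1) (1 - 1 / K) := by
    refine ⟨hm, hX, fun j hj hjd => hconn j (by omega) (by push_cast at hjd ⊢; omega),
      fun τ hτ => hl.trans (hgap τ ?_)⟩
    convert hτ using 2
    push_cast
    ring
  have hXgap := hloc.hasGap (by push_cast; linarith)
  have hlink : ∀ c ∈ X.simplices 0, (X.link c).HasGap (linkWeight m c) (1 / (K - d)) :=
    fun c hc => (hloc.link hc).hasGap (by linarith)
  have h1 := hsmall_gap d (by linarith)
  have h2 := hsmall_gap (d + 1 : ℕ) (by push_cast; linarith)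
  have h3 := pathSum_le_of_small hX hm (by omega) h2.1 h2.2 hXgap h1.1 h1.2 hlink hmin hsmall
  have h4 := cochainNorm_sub_pathSum_le hm (by omega) φ
  obtain ⟨e, he⟩ := exists_eq_one_of_ne_zero hφ
  have h5 := cochainNorm_pos hm he
  exact ⟨by linarith, by linarith⟩
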